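/- Let $S$ be a Polish space with its Borel $\sigma$-algebra, $C_b(S)$ the space of bounded continuous functions $S\to\mathbb R$, $\mathcal P(S)$ the set of Borel probability measures on $S$ and $\mathcal M(S)$ the space of finite signed Borel measures on $S$. Equip $C_b(S)$ with the weak topology induced by $\mathcal M(S)$, i.e. the coarsest topology for which $g\mapsto\int_S g\,d\mu$ is continuous for every $\mu\in\mathcal M(S)$. Call $\Gamma\subset C_b(S)$ *admissible* if 1. $\Gamma$ is convex and closed in this weak topology; 2. $g\in\Gamma$ implies $-g\in\Gamma$, and $\Gamma$ contains all constant functions; 3. for all $\mu,\nu\in\mathcal P(S)$ with $\mu\neq\nu$ there is $g\in\Gamma$ with $\int_S g\,d\mu\neq\int_S g\,d\nu$. For $\mu,\eta\in\mathcal M(S)$ and $\nu\in\mathcal P(S)$ define, with values in $[-\infty,\infty]$, $$G_\Gamma(\mu\|\nu)=\sup_{g\in\Gamma}\Big\{\int_S g\,d\mu-\log\int_S e^g\,d\nu\Big\},\qquad W_\Gamma(\eta)=\sup_{g\in\Gamma}\int_S g\,d\eta .$$ For $\gamma,\nu\in\mathcal P(S)$ let $R(\gamma\|\nu)=\int_S\log\frac{d\gamma}{d\nu}\,d\gamma\in[0,\infty]$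 if $\gamma\ll\nu$, and $R(\gamma\|\nu)=\infty$ otherwise. **Theorem.** If $\Gamma$ is admissible, then for all $\mu\in\mathcal M(S)$ and $\nu\in\mathcal P(S)$, $$G_\Gamma(\mu\|\nu)=\inf_{\gamma\in\mathcal P(S)}\big\{R(\gamma\|\nu)+W_\Gamma(\mu-\gamma)\big\},$$ as an equality of extended real numbers (both sides may be $+\infty$). -/

import Mathlib

open MeasureTheory InformationTheory BoundedContinuousFunction
open scoped Topology

noncomputable section

namespace GammaDivergence

variable {S : Type*} [TopologicalSpace S] [MeasurableSpace S]

/-- The weak topology on the space `C_b(S)` of bounded continuous functions induced by the finite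
signed measures: the coarsest topology making `g ↦ ∫ g dμ` continuous for every `μ ∈ M(S)`. -/
abbrev weakTopology (S : Type*) [TopologicalSpace S] [MeasurableSpace S] :
    TopologicalSpace (S →ᵇ ℝ) :=
  ⨅ μ : SignedMeasure S,
    TopologicalSpace.induced (fun g : S →ᵇ ℝ => ∫ᵛ x, g x ∂<•μ) inferInstance

/-- Admissible sets of test functions `Γ ⊆ C_b(S)`. -/
structure IsAdmissible (Γ : Set (S →ᵇ ℝ)) : Prop where
  convex : Convex ℝ Γ
  isClosed : IsClosed[weakTopology S] Γ
  symmetric : ∀ g ∈ Γ, -g ∈ Γ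
  const_mem : ∀ c : ℝ, BoundedContinuousFunction.const S c ∈ Γ
  determining : ∀ μ ν : ProbabilityMeasure S, μ ≠ ν →
    ∃ g ∈ Γ, ∫ x, g x ∂(μ : Measure S) ≠ ∫ x, g x ∂(ν : Measure S)

/-- The `Γ`-divergence `G_Γ(μ‖ν) = sup_{g ∈ Γ} {∫ g dμ - log ∫ e^g dν}` of a finite signed measure
`μ` from a probability measure `ν`, as an extended real number. -/
def gammaDiv (Γ : Set (S →ᵇ ℝ)) (μ : SignedMeasure S) (ν : ProbabilityMeasure S) : EReal :=
  ⨆ g ∈ Γ, ((∫ᵛ x, g x ∂<•μ - Real.log (∫ x, Real.exp (g x) ∂(ν : Measure S)) : ℝ) : EReal)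

/-- `W_Γ(η) = sup_{g ∈ Γ} ∫ g dη` for a finite signed measure `η`, as an extended real number. -/
def gammaW (Γ : Set (S →ᵇ ℝ)) (η : SignedMeasure S) : EReal :=
  ⨆ g ∈ Γ, ((∫ᵛ x, g x ∂<•η : ℝ) : EReal)

/-- The relative entropy `R(γ‖ν)` of probability measures: it is `∫ log (dγ/dν) dγ` when `γ ≪ ν`
(which is `+∞` when the integrand is not integrable, as its negative part always is), and `+∞`
otherwise. -/
def relEntropy (γ ν : ProbabilityMeasure S) : EReal :=
  ((klDiv (γ : Measure S) (ν : Measure S) : ENNReal) : EReal)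

end GammaDivergence

end

/-!
Write `φ g = ∫ g dμ - log ∫ e^g dν`, so that `G_Γ(μ‖ν)` is the supremum `G` of the concave function
`φ` over the convex set `Γ`. The bound of `G` by the infimum is the easy half of the
Donsker–Varadhan formula, `integral_sub_logPartition_le_toReal_klDiv`.

For the other bound it suffices, when `G` is finite, to find one probability measure `γ` with
`R(γ‖ν) + ∫ h d(μ - γ) ≤ G` for all `h ∈ Γ`
(`exists_probabilityMeasure_klDiv_add_le`). No minimax theorem or weak compactness is needed, because
`φ` is uniformly concave in terms of the Gibbs measures `e^g ν / ∫ e^g dν`: the value of `φ` at a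
midpoint exceeds the mean of the two values by minus the logarithm of the Hellinger affinity of the
two Gibbs measures. Hence the square roots of the Gibbs densities along a maximizing sequence `g_n`
form a Cauchy sequence in `L²(ν)` (`norm_gibbsRootLp_sub_sq_le`), and `γ` is the measure whose
density is the square of the limit.

Given `h ∈ Γ`, let `k_n` maximize `φ` over the segment from `g_n` to `h`. The first-order condition
at `k_n` says exactly that the Gibbs measure `γ_n` of `k_n` satisfies
`R(γ_n‖ν) + ∫ h d(μ - γ_n) ≤ φ k_n ≤ G` (`exists_gibbs_of_segment`). Since `φ k_n ≥ φ g_n`, the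
sequence `k_n` is again maximizing, so its Gibbs densities have the same limit as those of `g_n`,
and Fatou's lemma (`lintegral_klFun_sq_le_of_tendsto`) carries the inequality over to `γ`.
-/

namespace GammaDivergence

/-! ### Gibbs measures and the log-partition function -/

section Gibbs

variable {S : Type*} [TopologicalSpace S] [MeasurableSpace S] [OpensMeasurableSpace S]
  (ν : Measure S) [IsProbabilityMeasure ν]

/-- The log-partition function `g ↦ log ∫ e^g dν`. -/
noncomputable def logPartition (ν : Measure S) (g : S →ᵇ ℝ) : ℝ := Real.log (∫ x, Real.exp (g x) ∂ν)

/-- The square root `e^{(g - log ∫ e^g dν) / 2}` of the density of the Gibbs measure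
`e^g ν / ∫ e^g dν` with respect to `ν`. -/
noncomputable def gibbsRoot (ν : Measure S) (g : S →ᵇ ℝ) (x : S) : ℝ :=
  Real.exp ((g x - logPartition ν g) / 2)

omit [OpensMeasurableSpace S] [IsProbabilityMeasure ν] in
lemma gibbsRoot_sq (g : S →ᵇ ℝ) (x : S) :
    gibbsRoot ν g x ^ 2 = Real.exp (g x - logPartition ν g) := by
  rw [gibbsRoot, ← Real.exp_nat_mul]; congr 1; push_cast; ring

lemma integrable_comp_boundedContinuous (g h : S →ᵇ ℝ) {F : ℝ × ℝ → ℝ} (hF : Continuous F) :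
    Integrable (fun x => F (g x, h x)) ν := by
  obtain ⟨C, hC⟩ := ((isCompact_closedBall (0 : ℝ) ‖g‖).prod
    (isCompact_closedBall (0 : ℝ) ‖h‖)).exists_bound_of_continuousOn hF.continuousOn
  refine Integrable.of_bound
    (hF.comp (g.continuous.prodMk h.continuous)).measurable.aestronglyMeasurable C
    (ae_of_all _ fun x => hC _ ⟨?_, ?_⟩)
  · simpa using g.norm_coe_le_norm x
  · simpa using h.norm_coe_le_norm x

lemma integrable_exp_boundedContinuous (g : S →ᵇ ℝ) : Integrable (fun x => Real.exp (g x)) ν :=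
  integrable_comp_boundedContinuous ν g 0 (F := fun p => Real.exp p.1) (by fun_prop)

lemma integral_exp_boundedContinuous_pos (g : S →ᵇ ℝ) : 0 < ∫ x, Real.exp (g x) ∂ν :=
  integral_exp_pos (integrable_exp_boundedContinuous ν g)

lemma exp_logPartition (g : S →ᵇ ℝ) : Real.exp (logPartition ν g) = ∫ x, Real.exp (g x) ∂ν :=
  Real.exp_log (integral_exp_boundedContinuous_pos ν g)

lemma integral_gibbsRoot_sq_mul (g h : S →ᵇ ℝ) :
    ∫ x, gibbsRoot ν g x ^ 2 * Real.exp (h x) ∂ν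
      = Real.exp (logPartition ν (g + h) - logPartition ν g) := by
  rw [Real.exp_sub, exp_logPartition, div_eq_mul_inv, ← Real.exp_neg, ← integral_mul_const]
  refine integral_congr_ae (ae_of_all _ fun x => ?_)
  simp only [gibbsRoot_sq, BoundedContinuousFunction.coe_add, Pi.add_apply, ← Real.exp_add]
  congr 1; ring

lemma integral_gibbsRoot_sq (g : S →ᵇ ℝ) : ∫ x, gibbsRoot ν g x ^ 2 ∂ν = 1 := by
  simpa using integral_gibbsRoot_sq_mul ν g 0

/-- The Hellinger affinity of two Gibbs measures measures how far the log-partition function is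
from being affine between the two potentials. -/
lemma integral_gibbsRoot_mul_gibbsRoot (g h : S →ᵇ ℝ) :
    ∫ x, gibbsRoot ν g x * gibbsRoot ν h x ∂ν
      = Real.exp (logPartition ν ((1 / 2 : ℝ) • g + (1 / 2 : ℝ) • h)
          - (logPartition ν g + logPartition ν h) / 2) := by
  rw [Real.exp_sub, exp_logPartition, div_eq_mul_inv, ← Real.exp_neg, ← integral_mul_const]
  refine integral_congr_ae (ae_of_all _ fun x => ?_)
  simp only [gibbsRoot, BoundedContinuousFunction.coe_add, Pi.add_apply,
    BoundedContinuousFunction.coe_smul, smul_eq_mul, ← Real.exp_add]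
  congr 1; ring

lemma memLp_gibbsRoot (g : S →ᵇ ℝ) : MemLp (gibbsRoot ν g) 2 ν := by
  have hm : AEStronglyMeasurable (gibbsRoot ν g) ν :=
    (integrable_comp_boundedContinuous ν g 0
      (F := fun p => Real.exp ((p.1 - logPartition ν g) / 2)) (by fun_prop)).1
  rw [memLp_two_iff_integrable_sq hm]
  simp only [gibbsRoot_sq]
  exact integrable_comp_boundedContinuous ν g 0
      (F := fun p => Real.exp (p.1 - logPartition ν g)) (by fun_prop)

/-- The square root of the Gibbs density as an element of `L²(ν)`. -/
noncomputable def gibbsRootLp (g : S →ᵇ ℝ) : Lp ℝ 2 ν := (memLp_gibbsRoot ν g).toLp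

lemma coeFn_gibbsRootLp (g : S →ᵇ ℝ) : gibbsRootLp ν g =ᵐ[ν] gibbsRoot ν g :=
  MemLp.coeFn_toLp _

lemma inner_gibbsRootLp (g h : S →ᵇ ℝ) :
    inner ℝ (gibbsRootLp ν g) (gibbsRootLp ν h) = ∫ x, gibbsRoot ν g x * gibbsRoot ν h x ∂ν := by
  rw [MeasureTheory.L2.inner_def]
  refine integral_congr_ae ?_
  filter_upwards [coeFn_gibbsRootLp ν g, coeFn_gibbsRootLp ν h] with x hg hh
  simp [hg, hh, mul_comm]

lemma norm_gibbsRootLp_sq (g : S →ᵇ ℝ) : ‖gibbsRootLp ν g‖ ^ 2 = 1 := by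
  rw [← real_inner_self_eq_norm_sq, inner_gibbsRootLp, ← integral_gibbsRoot_sq ν g]
  simp only [sq]

lemma logPartition_le_add_norm_sub (g h : S →ᵇ ℝ) :
    logPartition ν g ≤ logPartition ν h + ‖g - h‖ := by
  rw [← Real.exp_le_exp, Real.exp_add, exp_logPartition, exp_logPartition, ← integral_mul_const]
  refine integral_mono (integrable_exp_boundedContinuous ν g)
    ((integrable_exp_boundedContinuous ν h).mul_const _) fun x => ?_
  simp only [← Real.exp_add]
  have := (le_abs_self _).trans ((g - h).norm_coe_le_norm x)
  simp only [BoundedContinuousFunction.coe_sub, Pi.sub_apply] at this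
  exact Real.exp_le_exp.2 (by linarith)

lemma continuous_logPartition : Continuous (logPartition ν) := by
  refine (LipschitzWith.of_le_add fun g h => ?_).continuous (f := logPartition ν)
  rw [dist_eq_norm]
  exact logPartition_le_add_norm_sub ν g h

end Gibbs

/-! ### First- and second-order behaviour of the dual functional -/

section Dual

variable {S : Type*} [TopologicalSpace S] [MeasurableSpace S] [OpensMeasurableSpace S]
  (ν : Measure S) [IsProbabilityMeasure ν] (L : (S →ᵇ ℝ) →ₗ[ℝ] ℝ)

/-- Two near maximizers of `g ↦ L g - log ∫ e^g dν` over a convex set have close Gibbs densities,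
because the value at their midpoint exceeds the mean value by minus the logarithm of their
Hellinger affinity. -/
lemma norm_gibbsRootLp_sub_sq_le {G ε : ℝ} {g h : S →ᵇ ℝ}
    (hmid : L ((1 / 2 : ℝ) • g + (1 / 2 : ℝ) • h)
      - logPartition ν ((1 / 2 : ℝ) • g + (1 / 2 : ℝ) • h) ≤ G)
    (hg : G - ε ≤ L g - logPartition ν g) (hh : G - ε ≤ L h - logPartition ν h) :
    ‖gibbsRootLp ν g - gibbsRootLp ν h‖ ^ 2 ≤ 2 * ε := by
  rw [norm_sub_sq_real, norm_gibbsRootLp_sq, norm_gibbsRootLp_sq, inner_gibbsRootLp,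
    integral_gibbsRoot_mul_gibbsRoot]
  have h1 := Real.add_one_le_exp (logPartition ν ((1 / 2 : ℝ) • g + (1 / 2 : ℝ) • h)
          - (logPartition ν g + logPartition ν h) / 2)
  simp only [map_add, map_smul, smul_eq_mul] at hmid
  linarith

/-- If `g` maximizes `g ↦ L g - log ∫ e^g dν` along the segment from `g` to `g + v`, then the
derivative of this function at `g` in the direction `v` is nonpositive. -/
lemma apply_le_integral_gibbs_of_isMax {g v : S →ᵇ ℝ}
    (hmax : ∀ s : ℝ, 0 ≤ s → s ≤ 1 →
      L (g + s • v) - logPartition ν (g + s • v) ≤ L g - logPartition ν g) :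
    L v ≤ ∫ x, gibbsRoot ν g x ^ 2 * v x ∂ν := by
  have hint : ∀ F : ℝ × ℝ → ℝ, Continuous F →
      Integrable (fun x => gibbsRoot ν g x ^ 2 * F (g x, v x)) ν := fun F hF => by
    simp only [gibbsRoot_sq]
    exact integrable_comp_boundedContinuous ν g v
      (F := fun p => Real.exp (p.1 - logPartition ν g) * F p) (by fun_prop)
  -- the second-order Taylor bound for `exp` makes the difference quotient explicit
  have key : ∀ s : ℝ, 0 < s → s ≤ 1 → s * ‖v‖ ≤ 1 →
      L v ≤ ∫ x, gibbsRoot ν g x ^ 2 * v x ∂ν + s * ‖v‖ ^ 2 := by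
    intro s hs hs1 hsv
    have h1 := hmax s hs.le hs1
    simp only [map_add, map_smul, smul_eq_mul] at h1
    have h2 := Real.add_one_le_exp (logPartition ν (g + s • v) - logPartition ν g)
    rw [← integral_gibbsRoot_sq_mul ν g (s • v)] at h2
    have h3 : ∫ x, gibbsRoot ν g x ^ 2 * Real.exp ((s • v) x) ∂ν
        ≤ ∫ x, ((1 + (s * ‖v‖) ^ 2) * gibbsRoot ν g x ^ 2
            + s * (gibbsRoot ν g x ^ 2 * v x)) ∂ν := by
      refine integral_mono (hint (fun p => Real.exp (s * p.2)) (by fun_prop))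
        (((memLp_gibbsRoot ν g).integrable_sq.const_mul _).add
          ((hint (fun p => p.2) (by fun_prop)).const_mul _)) fun x => ?_
      have hvx : |v x| ≤ ‖v‖ := v.norm_coe_le_norm x
      have habs : |s * v x| ≤ s * ‖v‖ := by
        rw [abs_mul, abs_of_pos hs]; gcongr
      have h4 := (le_abs_self _).trans (Real.abs_exp_sub_one_sub_id_le (habs.trans hsv))
      have h5 : (s * v x) ^ 2 ≤ (s * ‖v‖) ^ 2 := sq_le_sq' (by linarith [(abs_le.1 habs).1])
        (abs_le.1 habs).2
      have h6 : Real.exp ((s • v) x) ≤ 1 + (s * ‖v‖) ^ 2 + s * v x := by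
        simp only [BoundedContinuousFunction.coe_smul, smul_eq_mul]; linarith
      calc gibbsRoot ν g x ^ 2 * Real.exp ((s • v) x)
          ≤ gibbsRoot ν g x ^ 2 * (1 + (s * ‖v‖) ^ 2 + s * v x) := by gcongr
        _ = _ := by ring
    rw [integral_add ((memLp_gibbsRoot ν g).integrable_sq.const_mul _)
          ((hint (fun p => p.2) (by fun_prop)).const_mul _), integral_const_mul,
      integral_const_mul, integral_gibbsRoot_sq] at h3
    have h7 : s * L v ≤ s * (∫ x, gibbsRoot ν g x ^ 2 * v x ∂ν + s * ‖v‖ ^ 2) := by linarith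
    exact le_of_mul_le_mul_left h7 hs
  have hlim : Filter.Tendsto (fun s : ℝ => ∫ x, gibbsRoot ν g x ^ 2 * v x ∂ν + s * ‖v‖ ^ 2)
      (𝓝[>] 0) (𝓝 (∫ x, gibbsRoot ν g x ^ 2 * v x ∂ν + 0 * ‖v‖ ^ 2)) :=
    tendsto_nhdsWithin_of_tendsto_nhds (Continuous.tendsto (by fun_prop) 0)
  rw [zero_mul, add_zero] at hlim
  refine ge_of_tendsto hlim ?_
  have hsv : ∀ᶠ s : ℝ in 𝓝 0, s * ‖v‖ < 1 :=
    (Continuous.tendsto (f := fun s : ℝ => s * ‖v‖) (by fun_prop) 0).eventually_lt_const (by simp)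
  filter_upwards [self_mem_nhdsWithin, nhdsWithin_le_nhds (eventually_lt_nhds zero_lt_one),
    nhdsWithin_le_nhds hsv] with s h0 h1 h2
  exact key s h0 h1.le h2.le

/-- Maximizing `g ↦ L g - log ∫ e^g dν` over the segment from `g` to `h` produces a Gibbs measure
`γ` of some potential `k` with `R(γ‖ν) + L h - ∫ h dγ ≤ L k - log ∫ e^k dν`. -/
lemma exists_gibbs_of_segment {Γ : Set (S →ᵇ ℝ)} (hΓ : Convex ℝ Γ) {g h : S →ᵇ ℝ} (hg : g ∈ Γ)
    (hh : h ∈ Γ) :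
    ∃ k ∈ Γ, L g - logPartition ν g ≤ L k - logPartition ν k ∧
      ∫ x, gibbsRoot ν k x ^ 2 * (k x - logPartition ν k - h x) ∂ν + L h
        ≤ L k - logPartition ν k := by
  have hcont : Continuous fun t : ℝ =>
      L (g + t • (h - g)) - logPartition ν (g + t • (h - g)) := by
    simp only [map_add, map_smul, smul_eq_mul]
    exact (by fun_prop : Continuous fun t : ℝ => L g + t * L (h - g)).sub
      ((continuous_logPartition ν).comp (by fun_prop))
  obtain ⟨t, ht, hmax⟩ := isCompact_Icc.exists_isMaxOn (s := Set.Icc (0 : ℝ) 1)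
    (Set.nonempty_Icc.2 zero_le_one) hcont.continuousOn
  rw [isMaxOn_iff] at hmax
  have hmem : g + t • (h - g) ∈ Γ := hΓ.add_smul_sub_mem hg hh ht
  have h0 := hmax 0 ⟨le_rfl, zero_le_one⟩
  simp only [zero_smul, add_zero] at h0
  set k := g + t • (h - g) with hk
  refine ⟨k, hmem, h0, ?_⟩
  have hder : L (h - k) ≤ ∫ x, gibbsRoot ν k x ^ 2 * (h - k) x ∂ν := by
    refine apply_le_integral_gibbs_of_isMax ν L fun s hs0 hs1 => ?_
    have hst : t + s * (1 - t) ∈ Set.Icc (0 : ℝ) 1 := by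
      constructor <;> nlinarith [ht.1, ht.2]
    have heq : k + s • (h - k) = g + (t + s * (1 - t)) • (h - g) := by
      rw [hk]; module
    rw [heq]
    exact hmax _ hst
  have hi := (memLp_gibbsRoot ν k).integrable_sq
  have hint : Integrable (fun x => gibbsRoot ν k x ^ 2 * (h - k) x) ν := by
    simp only [gibbsRoot_sq]
    exact integrable_comp_boundedContinuous ν k (h - k)
      (F := fun p => Real.exp (p.1 - logPartition ν k) * p.2) (by fun_prop)
  have hsplit : ∫ x, gibbsRoot ν k x ^ 2 * (k x - logPartition ν k - h x) ∂ν
      = -logPartition ν k - ∫ x, gibbsRoot ν k x ^ 2 * (h - k) x ∂ν := by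
    have : ∀ x, gibbsRoot ν k x ^ 2 * (k x - logPartition ν k - h x)
        = (-logPartition ν k) * gibbsRoot ν k x ^ 2 - gibbsRoot ν k x ^ 2 * (h - k) x := by
      intro x
      simp only [BoundedContinuousFunction.coe_sub, Pi.sub_apply]; ring
    simp only [this]
    rw [integral_sub (hi.const_mul _) hint, integral_const_mul, integral_gibbsRoot_sq, mul_one]
  rw [hsplit]
  simp only [map_sub] at hder
  linarith

end Dual

/-! ### Existence of an optimal measure -/

section Limit

variable {S : Type*} [TopologicalSpace S] [MeasurableSpace S] [OpensMeasurableSpace S]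
  (ν : Measure S) [IsProbabilityMeasure ν] (L : (S →ᵇ ℝ) →ₗ[ℝ] ℝ)

/-- Young's inequality for the convex conjugates `klFun` and `y ↦ e^y - 1`. -/
lemma mul_le_klFun_add_exp_sub_one {p : ℝ} (hp : 0 ≤ p) (y : ℝ) :
    p * y ≤ klFun p + Real.exp y - 1 := by
  rw [klFun_apply]
  rcases hp.eq_or_lt with rfl | hp
  · simp [Real.exp_nonneg]
  · have h1 := Real.add_one_le_exp (y - Real.log p)
    have h2 : Real.exp y = p * Real.exp (y - Real.log p) := by
      rw [Real.exp_sub, Real.exp_log hp, mul_div_cancel₀ _ hp.ne']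
    nlinarith

lemma continuous_klFun_sub_mul :
    Continuous fun p : ℝ × ℝ => klFun p.1 - p.1 * p.2 + Real.exp p.2 - 1 := by
  have := continuous_klFun
  fun_prop

/-- The entropy of the Gibbs measure of `k` relative to `ν` is the integral of
`k - log ∫ e^k dν` against it; the terms in `h` make the integrand on the left nonnegative. -/
lemma integral_klFun_gibbsRoot_sq (k h : S →ᵇ ℝ) :
    ∫ x, (klFun (gibbsRoot ν k x ^ 2) - gibbsRoot ν k x ^ 2 * h x + Real.exp (h x) - 1) ∂ν
      = ∫ x, gibbsRoot ν k x ^ 2 * (k x - logPartition ν k - h x) ∂ν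
        + ∫ x, Real.exp (h x) ∂ν - 1 := by
  have hi := (memLp_gibbsRoot ν k).integrable_sq
  have hint : Integrable (fun x => gibbsRoot ν k x ^ 2 * (k x - logPartition ν k - h x)) ν := by
    simp only [gibbsRoot_sq]
    exact integrable_comp_boundedContinuous ν k h
      (F := fun p => Real.exp (p.1 - logPartition ν k) * (p.1 - logPartition ν k - p.2))
      (by fun_prop)
  have hexp := integrable_exp_boundedContinuous ν h
  have : ∀ x, klFun (gibbsRoot ν k x ^ 2) - gibbsRoot ν k x ^ 2 * h x + Real.exp (h x) - 1
      = gibbsRoot ν k x ^ 2 * (k x - logPartition ν k - h x) + Real.exp (h x)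
        - gibbsRoot ν k x ^ 2 := by
    intro x
    rw [klFun_apply, gibbsRoot_sq, Real.log_exp]; ring
  simp only [this]
  rw [integral_sub (hint.fun_add hexp) hi, integral_add hint hexp, integral_gibbsRoot_sq]

/-- Lower semicontinuity of `γ ↦ R(γ‖ν) - ∫ h dγ` under `L²` convergence of the square roots of the
densities, in the form of a bound on the nonnegative integrand
`klFun p - p h + e^h - 1`. -/
lemma lintegral_klFun_sq_le_of_tendsto {r : Lp ℝ 2 ν} {k : ℕ → S →ᵇ ℝ} (h : S →ᵇ ℝ) {C : ℝ}
    (hk : Filter.Tendsto (fun n => gibbsRootLp ν (k n)) Filter.atTop (𝓝 r))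
    (hC : ∀ n, ∫ x, gibbsRoot ν (k n) x ^ 2 * (k n x - logPartition ν (k n) - h x) ∂ν ≤ C) :
    ∫⁻ x, ENNReal.ofReal (klFun (r x ^ 2) - r x ^ 2 * h x + Real.exp (h x) - 1) ∂ν
      ≤ ENNReal.ofReal (C + ∫ x, Real.exp (h x) ∂ν - 1) := by
  obtain ⟨φ, -, hφ⟩ := (tendstoInMeasure_of_tendsto_Lp hk).exists_seq_tendsto_ae
  have hroot : ∀ᵐ x ∂ν, ∀ n, gibbsRootLp ν (k n) x = gibbsRoot ν (k n) x :=
    ae_all_iff.2 fun n => coeFn_gibbsRootLp ν (k n)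
  set F : ℕ → S → ENNReal := fun n x => ENNReal.ofReal (klFun (gibbsRoot ν (k (φ n)) x ^ 2)
    - gibbsRoot ν (k (φ n)) x ^ 2 * h x + Real.exp (h x) - 1) with hF
  have hlim : ∀ᵐ x ∂ν, ENNReal.ofReal (klFun (r x ^ 2) - r x ^ 2 * h x + Real.exp (h x) - 1)
      = Filter.liminf (fun n => F n x) Filter.atTop := by
    filter_upwards [hφ, hroot] with x hx hx'
    simp only [hx'] at hx
    refine (Filter.Tendsto.liminf_eq ?_).symm
    have hpair : Filter.Tendsto (fun n => (gibbsRoot ν (k (φ n)) x ^ 2, h x)) Filter.atTop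
        (𝓝 (r x ^ 2, h x)) := (hx.pow 2).prodMk_nhds tendsto_const_nhds
    have hcomp := (continuous_klFun_sub_mul.tendsto (r x ^ 2, h x)).comp hpair
    exact ENNReal.tendsto_ofReal hcomp
  have hint : ∀ n, Integrable (fun x => klFun (gibbsRoot ν (k n) x ^ 2)
      - gibbsRoot ν (k n) x ^ 2 * h x + Real.exp (h x) - 1) ν := fun n => by
    simp only [gibbsRoot_sq]
    exact integrable_comp_boundedContinuous ν (k n) h
      (F := fun p => klFun (Real.exp (p.1 - logPartition ν (k n)))
        - Real.exp (p.1 - logPartition ν (k n)) * p.2 + Real.exp p.2 - 1)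
      (continuous_klFun_sub_mul.comp
        (by fun_prop : Continuous fun p : ℝ × ℝ => (Real.exp (p.1 - logPartition ν (k n)), p.2)))
  rw [lintegral_congr_ae hlim]
  refine (lintegral_liminf_le' fun n => (hint (φ n)).1.aemeasurable.ennreal_ofReal).trans ?_
  refine Filter.liminf_le_of_le (by isBoundedDefault) fun b hb => ?_
  obtain ⟨n, hn⟩ := hb.exists
  refine hn.trans ?_
  rw [← ofReal_integral_eq_lintegral_ofReal (hint (φ n)) (ae_of_all _ fun x => ?_),
    integral_klFun_gibbsRoot_sq]
  · exact ENNReal.ofReal_le_ofReal (by linarith [hC (φ n)])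
  · have := mul_le_klFun_add_exp_sub_one (sq_nonneg (gibbsRoot ν (k (φ n)) x)) (h x)
    simp only [Pi.zero_apply]
    linarith

/-- The Gibbs densities of a maximizing sequence of `g ↦ L g - log ∫ e^g dν` over a convex set `Γ`
converge in `L²`, after taking square roots, and passing to potentials in `Γ` with larger values
does not change the limit. -/
lemma exists_tendsto_gibbsRootLp {Γ : Set (S →ᵇ ℝ)} (hΓ : Convex ℝ Γ) {G : ℝ}
    (hG : ∀ g ∈ Γ, L g - logPartition ν g ≤ G) {g : ℕ → S →ᵇ ℝ} (hg : ∀ n, g n ∈ Γ)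
    (hgG : ∀ n : ℕ, G - 1 / ((n : ℝ) + 1) ≤ L (g n) - logPartition ν (g n)) :
    ∃ r : Lp ℝ 2 ν, ∀ k : ℕ → S →ᵇ ℝ, (∀ n, k n ∈ Γ) →
      (∀ n, L (g n) - logPartition ν (g n) ≤ L (k n) - logPartition ν (k n)) →
      Filter.Tendsto (fun n => gibbsRootLp ν (k n)) Filter.atTop (𝓝 r) := by
  have hclose : ∀ ε : ℝ, ∀ a ∈ Γ, ∀ b ∈ Γ, G - ε ≤ L a - logPartition ν a →
      G - ε ≤ L b - logPartition ν b → dist (gibbsRootLp ν a) (gibbsRootLp ν b) ≤ √(2 * ε) := by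
    intro ε a ha b hb haG hbG
    rw [dist_eq_norm]
    refine Real.le_sqrt_of_sq_le (norm_gibbsRootLp_sub_sq_le ν L (hG _ ?_) haG hbG)
    exact hΓ ha hb (by norm_num) (by norm_num) (by norm_num)
  have hzero : Filter.Tendsto (fun n : ℕ => √(2 * (1 / ((n : ℝ) + 1)))) Filter.atTop (𝓝 0) := by
    simpa using (tendsto_one_div_add_atTop_nhds_zero_nat.const_mul (2 : ℝ)).sqrt
  have hcauchy : CauchySeq fun n => gibbsRootLp ν (g n) := by
    refine cauchySeq_of_le_tendsto_0 (fun n : ℕ => √(2 * (1 / ((n : ℝ) + 1)))) ?_ hzero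
    intro n m N hn hm
    have hmono : ∀ j : ℕ, N ≤ j → G - 1 / ((N : ℝ) + 1) ≤ L (g j) - logPartition ν (g j) :=
      fun j hj => (sub_le_sub_left (Nat.one_div_le_one_div hj) G).trans (hgG j)
    exact hclose _ _ (hg n) _ (hg m) (hmono n hn) (hmono m hm)
  obtain ⟨r, hr⟩ := cauchySeq_tendsto_of_complete hcauchy
  refine ⟨r, fun k hk hkG => ?_⟩
  refine hr.congr_dist (squeeze_zero (fun _ => dist_nonneg) (fun n => ?_) hzero)
  exact hclose _ _ (hg n) _ (hk n) (hgG n) ((hgG n).trans (hkG n))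

/-- The dual problem is attained: if `G` is the supremum of `L g - log ∫ e^g dν` over a convex set
`Γ` containing `0`, some probability measure `γ` satisfies `R(γ‖ν) + L h - ∫ h dγ ≤ G` for all
`h ∈ Γ`. -/
theorem exists_probabilityMeasure_klDiv_add_le {Γ : Set (S →ᵇ ℝ)} (hΓ : Convex ℝ Γ)
    (h0 : (0 : S →ᵇ ℝ) ∈ Γ) {G : ℝ} (hG : ∀ g ∈ Γ, L g - logPartition ν g ≤ G)
    (hsup : ∀ ε > 0, ∃ g ∈ Γ, G - ε ≤ L g - logPartition ν g) :
    ∃ γ : ProbabilityMeasure S, klDiv (γ : Measure S) ν ≠ ⊤ ∧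
      ∀ h ∈ Γ, (klDiv (γ : Measure S) ν).toReal + (L h - ∫ x, h x ∂(γ : Measure S)) ≤ G := by
  choose g hg hgG using fun n : ℕ => hsup (1 / ((n : ℝ) + 1)) Nat.one_div_pos_of_nat
  obtain ⟨r, hr⟩ := exists_tendsto_gibbsRootLp ν L hΓ hG hg hgG
  have hr2 : Integrable (fun x => r x ^ 2) ν := (Lp.memLp r).integrable_sq
  have hrnorm : ∫ x, r x ^ 2 ∂ν = 1 := by
    have h1 : ‖r‖ ^ 2 = 1 := by
      refine tendsto_nhds_unique ((hr g hg fun _ => le_rfl).norm.pow 2) ?_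
      simp only [norm_gibbsRootLp_sq, tendsto_const_nhds]
    rw [← h1, ← real_inner_self_eq_norm_sq, MeasureTheory.L2.inner_def]
    simp [sq]
  have hdens : Measurable fun x => ENNReal.ofReal (r x ^ 2) :=
    ((Lp.stronglyMeasurable r).measurable.pow_const 2).ennreal_ofReal
  set γ : Measure S := ν.withDensity fun x => ENNReal.ofReal (r x ^ 2) with hγ
  have hprob : IsProbabilityMeasure γ := by
    refine ⟨?_⟩
    rw [hγ, withDensity_apply _ MeasurableSet.univ, Measure.restrict_univ,
      ← ofReal_integral_eq_lintegral_ofReal hr2 (ae_of_all _ fun x => sq_nonneg _), hrnorm,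
      ENNReal.ofReal_one]
  have hac : γ ≪ ν := withDensity_absolutelyContinuous _ _
  have hkl : klDiv γ ν = ∫⁻ x, ENNReal.ofReal (klFun (r x ^ 2)) ∂ν := by
    rw [klDiv_eq_lintegral_klFun_of_ac hac]
    refine lintegral_congr_ae ?_
    filter_upwards [Measure.rnDeriv_withDensity ν hdens] with x hx
    rw [hx, ENNReal.toReal_ofReal (sq_nonneg _)]
  have hfatou : ∀ h ∈ Γ,
      ∫⁻ x, ENNReal.ofReal (klFun (r x ^ 2) - r x ^ 2 * h x + Real.exp (h x) - 1) ∂ν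
        ≤ ENNReal.ofReal (G - L h + ∫ x, Real.exp (h x) ∂ν - 1) := by
    intro h hh
    choose k hk hkg hkh using fun n => exists_gibbs_of_segment ν L hΓ (hg n) hh
    refine lintegral_klFun_sq_le_of_tendsto ν h (hr k hk hkg) fun n => ?_
    linarith [hkh n, hG _ (hk n)]
  have hfin : klDiv γ ν ≠ ⊤ := by
    have hle := hfatou 0 h0
    simp only [BoundedContinuousFunction.coe_zero, Pi.zero_apply, mul_zero, sub_zero,
      Real.exp_zero, add_sub_cancel_right] at hle
    rw [hkl]
    exact ne_top_of_le_ne_top ENNReal.ofReal_ne_top hle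
  have hklint : Integrable (fun x => klFun (r x ^ 2)) ν := by
    refine ⟨(continuous_klFun.measurable.comp
      ((Lp.stronglyMeasurable r).measurable.pow_const 2)).aestronglyMeasurable, ?_⟩
    rw [hasFiniteIntegral_iff_ofReal (ae_of_all _ fun x => klFun_nonneg (sq_nonneg _)), ← hkl]
    exact hfin.lt_top
  have hklreal : (klDiv γ ν).toReal = ∫ x, klFun (r x ^ 2) ∂ν := by
    rw [hkl, ← ofReal_integral_eq_lintegral_ofReal hklint
      (ae_of_all _ fun x => klFun_nonneg (sq_nonneg _)), ENNReal.toReal_ofReal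
      (integral_nonneg fun x => klFun_nonneg (sq_nonneg _))]
  refine ⟨⟨γ, hprob⟩, hfin, fun h hh => ?_⟩
  change (klDiv γ ν).toReal + (L h - ∫ x, h x ∂γ) ≤ G
  have hγint : ∫ x, h x ∂γ = ∫ x, r x ^ 2 * h x ∂ν := by
    rw [hγ, integral_withDensity_eq_integral_toReal_smul hdens
      (ae_of_all _ fun x => ENNReal.ofReal_lt_top)]
    simp only [ENNReal.toReal_ofReal (sq_nonneg _), smul_eq_mul]
  have hrh : Integrable (fun x => r x ^ 2 * h x) ν :=
    hr2.mul_bdd (c := ‖h‖) h.continuous.measurable.aestronglyMeasurable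
      (ae_of_all _ fun x => h.norm_coe_le_norm x)
  have hexp := integrable_exp_boundedContinuous ν h
  have hdiff : Integrable (fun x => klFun (r x ^ 2) - r x ^ 2 * h x) ν := hklint.sub hrh
  have hall : Integrable (fun x => klFun (r x ^ 2) - r x ^ 2 * h x + Real.exp (h x) - 1) ν :=
    (hdiff.fun_add hexp).sub (integrable_const 1)
  have hnonneg : ∀ x, 0 ≤ klFun (r x ^ 2) - r x ^ 2 * h x + Real.exp (h x) - 1 := fun x => by
    linarith [mul_le_klFun_add_exp_sub_one (sq_nonneg (r x)) (h x)]
  have hle := hfatou h hh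
  rw [← ofReal_integral_eq_lintegral_ofReal hall (ae_of_all _ hnonneg)] at hle
  -- the bound is nonnegative, since it dominates `G - (L h - log ∫ e^h dν)`
  have hbound : 0 ≤ G - L h + ∫ x, Real.exp (h x) ∂ν - 1 := by
    have h1 := Real.log_le_sub_one_of_pos (integral_exp_boundedContinuous_pos ν h)
    have h2 := hG h hh
    rw [logPartition] at h2
    linarith
  rw [ENNReal.ofReal_le_ofReal_iff hbound, integral_sub (hdiff.fun_add hexp)
    (integrable_const _), integral_add hdiff hexp, integral_sub hklint hrh,
    integral_const, probReal_univ, one_smul] at hle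
  rw [hklreal, hγint]
  linarith

/-- The easy half of the Donsker–Varadhan formula, which is the nonnegativity of the entropy of `γ`
relative to the Gibbs measure `e^g ν / ∫ e^g dν`. -/
lemma integral_sub_logPartition_le_toReal_klDiv (γ : Measure S) [IsProbabilityMeasure γ]
    (hγ : klDiv γ ν ≠ ⊤) (g : S →ᵇ ℝ) :
    ∫ x, g x ∂γ - logPartition ν g ≤ (klDiv γ ν).toReal := by
  obtain ⟨hac, hint⟩ := klDiv_ne_top_iff.1 hγ
  have hexp := integrable_exp_boundedContinuous ν g
  have hprob : IsProbabilityMeasure (ν.tilted g) := isProbabilityMeasure_tilted hexp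
  have h1 := integral_llr_add_sub_measure_univ_nonneg
    (hac.trans (absolutelyContinuous_tilted hexp))
    (integrable_llr_tilted_right hac (g.integrable γ) hint hexp)
  rw [integral_llr_tilted_right hac (g.integrable γ) hexp hint] at h1
  rw [toReal_klDiv_of_measure_eq hac (by simp), logPartition]
  simp only [probReal_univ] at h1
  linarith

end Limit

/-! ### Integration against signed measures -/

section SignedMeasure

variable {S : Type*} [TopologicalSpace S] [MeasurableSpace S] [OpensMeasurableSpace S]

lemma integrable_signedMeasure (μ : SignedMeasure S) (g : S →ᵇ ℝ) : μ.Integrable g := by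
  have : IsFiniteMeasure μ.variation := by
    rw [← SignedMeasure.totalVariation_eq_variation, SignedMeasure.totalVariation]
    infer_instance
  exact g.integrable μ.variation

/-- Integration of bounded continuous functions against a finite signed measure, as a linear
functional. -/
noncomputable def integralLinear (μ : SignedMeasure S) : (S →ᵇ ℝ) →ₗ[ℝ] ℝ where
  toFun g := ∫ᵛ x, g x ∂<•μ
  map_add' g h := VectorMeasure.integral_add (integrable_signedMeasure μ g)
    (integrable_signedMeasure μ h)
  map_smul' c _ := VectorMeasure.integral_smul _ _ _ c

lemma integralLinear_apply (μ : SignedMeasure S) (g : S →ᵇ ℝ) :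
    integralLinear μ g = ∫ᵛ x, g x ∂<•μ := (rfl)

lemma integral_sub_toSignedMeasure (μ : SignedMeasure S) (γ : Measure S) [IsFiniteMeasure γ]
    (g : S →ᵇ ℝ) :
    ∫ᵛ x, g x ∂<•(μ - γ.toSignedMeasure) = integralLinear μ g - ∫ x, g x ∂γ := by
  rw [VectorMeasure.integral_sub_vectorMeasure (integrable_signedMeasure μ g)
    (integrable_signedMeasure _ g), VectorMeasure.integral_toSignedMeasure,
    integralLinear_apply]

end SignedMeasure

end GammaDivergence

theorem mainTheorem1 {S : Type*} [TopologicalSpace S] [PolishSpace S] [MeasurableSpace S]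
    [BorelSpace S] (Γ : Set (BoundedContinuousFunction S ℝ))
    (hΓ : GammaDivergence.IsAdmissible Γ)
    (μ : SignedMeasure S) (ν : ProbabilityMeasure S) :
    GammaDivergence.gammaDiv Γ μ ν =
      ⨅ γ : ProbabilityMeasure S,
        (GammaDivergence.relEntropy γ ν
          + GammaDivergence.gammaW Γ (μ - (γ : Measure S).toSignedMeasure)) := by
  have h0 : (0 : S →ᵇ ℝ) ∈ Γ := hΓ.const_mem 0
  have hdiv : GammaDivergence.gammaDiv Γ μ ν = ⨆ g ∈ Γ,
      ((GammaDivergence.integralLinear μ g - GammaDivergence.logPartition (ν : Measure S) g : ℝ) :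
        EReal) := by
    simp only [GammaDivergence.integralLinear_apply]
    rfl
  have hentropy : ∀ γ : ProbabilityMeasure S, klDiv (γ : Measure S) (ν : Measure S) ≠ ⊤ →
      GammaDivergence.relEntropy γ ν
        = ((klDiv (γ : Measure S) (ν : Measure S)).toReal : EReal) := fun γ hγ =>
    (EReal.coe_ennreal_toReal hγ).symm
  refine le_antisymm (le_iInf fun γ => ?_) ?_
  · have hW : ∀ g ∈ Γ, ((GammaDivergence.integralLinear μ g - ∫ x, g x ∂(γ : Measure S) : ℝ) :
        EReal) ≤ GammaDivergence.gammaW Γ (μ - (γ : Measure S).toSignedMeasure) := fun g hg => by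
      rw [← GammaDivergence.integral_sub_toSignedMeasure]
      exact le_iSup₂_of_le g hg le_rfl
    by_cases hγ : klDiv (γ : Measure S) (ν : Measure S) = ⊤
    · -- since `0 ∈ Γ`, the second summand is not `-∞`
      have hne : GammaDivergence.gammaW Γ (μ - (γ : Measure S).toSignedMeasure) ≠ ⊥ :=
        ne_bot_of_le_ne_bot (EReal.coe_ne_bot _) (hW 0 h0)
      rw [GammaDivergence.relEntropy, hγ, EReal.coe_ennreal_top, EReal.top_add_of_ne_bot hne]
      exact le_top
    · rw [hentropy γ hγ, hdiv]
      refine iSup₂_le fun g hg => ?_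
      refine le_trans ?_ (add_le_add_right (hW g hg) _)
      rw [← EReal.coe_add, EReal.coe_le_coe_iff]
      linarith [GammaDivergence.integral_sub_logPartition_le_toReal_klDiv
        (ν : Measure S) (γ : Measure S) hγ g]
  · have hle : ∀ g ∈ Γ, ((GammaDivergence.integralLinear μ g
        - GammaDivergence.logPartition (ν : Measure S) g : ℝ) : EReal)
        ≤ GammaDivergence.gammaDiv Γ μ ν := fun g hg => by
      rw [hdiv]; exact le_iSup₂_of_le g hg le_rfl
    rcases eq_or_ne (GammaDivergence.gammaDiv Γ μ ν) ⊤ with htop | htop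
    · rw [htop]; exact le_top
    have hbot : GammaDivergence.gammaDiv Γ μ ν ≠ ⊥ :=
      ne_bot_of_le_ne_bot (EReal.coe_ne_bot _) (hle 0 h0)
    obtain ⟨G, hG⟩ : ∃ G : ℝ, (G : EReal) = GammaDivergence.gammaDiv Γ μ ν :=
      ⟨_, EReal.coe_toReal htop hbot⟩
    rw [← hG] at hle hdiv ⊢
    obtain ⟨γ, hγ, hγG⟩ := GammaDivergence.exists_probabilityMeasure_klDiv_add_le
      (ν : Measure S) (GammaDivergence.integralLinear μ) hΓ.convex h0
      (fun g hg => EReal.coe_le_coe_iff.1 (hle g hg)) fun ε hε => by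
        have hlt : ((G - ε : ℝ) : EReal) < G := EReal.coe_lt_coe_iff.2 (sub_lt_self G hε)
        rw [hdiv] at hlt
        obtain ⟨g, hg, hgε⟩ : ∃ g ∈ Γ, ((G - ε : ℝ) : EReal)
            < ((GammaDivergence.integralLinear μ g
              - GammaDivergence.logPartition (ν : Measure S) g : ℝ) : EReal) := by
          simpa only [lt_iSup_iff, exists_prop] using hlt
        exact ⟨g, hg, (EReal.coe_lt_coe_iff.1 hgε).le⟩
    refine iInf_le_of_le γ ?_
    have hW : GammaDivergence.gammaW Γ (μ - (γ : Measure S).toSignedMeasure)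
        ≤ ((G - (klDiv (γ : Measure S) (ν : Measure S)).toReal : ℝ) : EReal) := by
      refine iSup₂_le fun h hh => ?_
      rw [GammaDivergence.integral_sub_toSignedMeasure, EReal.coe_le_coe_iff]
      linarith [hγG h hh]
    rw [hentropy γ hγ]
    refine (add_le_add_right hW _).trans ?_
    rw [← EReal.coe_add, EReal.coe_le_coe_iff]
    linarith
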